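/- Let $\mathcal{A}$ be a Grothendieck category and let $\mathcal{B}\subseteq\mathcal{A}$ be a Serre subcategory (a full subcategory containing $0$ and closed under subobjects, quotients and extensions). Assume that $\mathcal{B}$ is localizing, i.e. the inclusion $\mathcal{B}\hookrightarrow\mathcal{A}$ has a right adjoint $\tau:\mathcal{A}\to\mathcal{B}$, and that $\mathcal{B}$ is closed under essential monomorphisms, i.e. if $i:X\to Y$ is an essential monomorphism in $\mathcal{A}$ with $X\in\mathcal{B}$, then $Y\in\mathcal{B}$. (A monomorphism $i:X\to Y$ is essential if every $g:Y\to Z$ such that $g\circ i$ is a monomorphism is itself a monomorphism.) Let $\pi:\mathcal{A}\to\mathcal{A}/\mathcal{B}$ be the quotient functor to the Serre quotient and let $\omega:\mathcal{A}/\mathcal{B}\to\mathcal{A}$ be its right adjoint. For a left exact functor $F$ on an abelian category with enough injective objects, put $\operatorname{coh.dim}F=\sup\{n\ge 0 : R^nF\ne 0\}$, and for an object $X$ of an abelian category $\mathcal{C}$ put $\operatorname{proj.dim}X=\sup\{n\ge 0 : \operatorname{Ext}^n_{\mathcal{C}}(X,Y)\neq 0\text{ for some object }Y\}$. Both suprema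 are taken in $\{0,1,2,\dots\}\cup\{\infty\}$, so that $\sup\emptyset=0$. Let $T$ be a generator of $\mathcal{A}$ with $\operatorname{proj.dim}T<\infty$. Then $$\operatorname{proj.dim}\pi(T)<\infty\iff\operatorname{coh.dim}\omega<\infty\iff\operatorname{coh.dim}\tau<\infty .$$ Moreover, $$\operatorname{coh.dim}\omega=\max\{0,\operatorname{coh.dim}\tau-1\}\quad\text{and}\quad\operatorname{coh.dim}\omega\le\operatorname{proj.dim}\pi(T)\le\operatorname{coh.dim}\omega+\operatorname{proj.dim}T .$$ -/

import Mathlib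

open CategoryTheory CategoryTheory.Limits

universe w v u v' u'

namespace SerreQuot

section Basic

variable {C : Type u} [Category.{v} C]

/-- A monomorphism `i : X ⟶ Y` is essential if any `g : Y ⟶ Z` such that `i ≫ g` is a
monomorphism is itself a monomorphism. -/
def IsEssentialMono {X Y : C} (i : X ⟶ Y) : Prop :=
  Mono i ∧ ∀ ⦃Z : C⦄ (g : Y ⟶ Z), Mono (i ≫ g) → Mono g

/-- A full subcategory, given by a property `B` of objects, is closed under essential
monomorphisms if the target of an essential monomorphism lies in it as soon as the source does. -/
class IsClosedUnderEssentialMonos (B : ObjectProperty C) : Prop where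
  prop_of_isEssentialMono : ∀ ⦃X Y : C⦄ (i : X ⟶ Y), IsEssentialMono i → B X → B Y

/-- A full subcategory `B` is localizing if the inclusion functor `B ⥤ C` has a right adjoint.
(It is used below for Serre subcategories only.) -/
class IsLocalizing (B : ObjectProperty C) : Prop where
  isLeftAdjoint_ι : B.ι.IsLeftAdjoint

attribute [instance] IsLocalizing.isLeftAdjoint_ι

end Basic

/-! ### Cohomological dimension of a functor and projective dimension of an object -/

/-- The cohomological dimension of an additive functor `F`: the supremum in `ℕ∞` of the set of
all `n ≥ 0` such that the `n`-th right derived functor of `F` is nonzero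
(the supremum of the empty set is `0`). -/
noncomputable def cohDim {C : Type u} [Category.{v} C] [Abelian C] [HasInjectiveResolutions C]
    {D : Type u'} [Category.{v'} D] [Abelian D] (F : C ⥤ D) [F.Additive] : ℕ∞ :=
  sSup ((fun n : ℕ => (n : ℕ∞)) '' {n : ℕ | ¬ IsZero (F.rightDerived n)})

/-- The projective dimension of `X`: the supremum in `ℕ∞` of the set of all `n ≥ 0` such that
`Extⁿ(X, Y) ≠ 0` for some object `Y` (the supremum of the empty set is `0`). The groups `Ext` are
the Hom-groups in the derived category, taken in the universe where they always exist. -/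
noncomputable def projDim {C : Type u} [Category.{v} C] [Abelian C] (X : C) : ℕ∞ :=
  letI := HasExt.standard C
  sSup ((fun n : ℕ => (n : ℕ∞)) ''
    {n : ℕ | ∃ Y : C, Nontrivial (Abelian.Ext.{max u v} X Y n)})

/-- Comparison with Mathlib's projective dimension, which has the value `⊥` at zero objects. -/
lemma projDim_le_iff {C : Type u} [Category.{v} C] [Abelian C] (X : C) (n : ℕ) :
    projDim X ≤ n ↔ HasProjectiveDimensionLE X n := by
  let := HasExt.standard C
  simp only [projDim, sSup_le_iff, Set.forall_mem_image, Nat.cast_le]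
  constructor
  · intro h
    refine (hasProjectiveDimensionLT_iff X (n + 1)).2 fun i hi Y e => ?_
    by_contra he
    have := h (x := i) ⟨Y, ⟨e, 0, he⟩⟩
    omega
  · rintro h i ⟨Y, hY⟩
    by_contra! hi
    have := HasProjectiveDimensionLT.subsingleton X (n + 1) i hi Y
    exact not_subsingleton (Abelian.Ext X Y i) this

/-! ### The torsion functor and the quotient category -/

section Defs

variable {A : Type u} [Category.{v} A] [Abelian A] (B : ObjectProperty A) [B.IsSerreClass]

/-- A Serre subcategory is closed under binary products. -/
instance : B.IsClosedUnderBinaryProducts where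
  limitsOfShape_le := by
    rintro X ⟨p⟩
    let l : X ⟶ p.diag.obj ⟨WalkingPair.left⟩ ⊞ p.diag.obj ⟨WalkingPair.right⟩ :=
      biprod.lift (p.π.app _) (p.π.app _)
    have hl : ∀ {W : A} (g : W ⟶ X), g ≫ l = 0 → g = 0 := fun g hg => by
      refine p.isLimit.hom_ext ?_
      rintro ⟨_ | _⟩
      · simpa [l] using congrArg (fun k => k ≫ biprod.fst) hg
      · simpa [l] using congrArg (fun k => k ≫ biprod.snd) hg
    have : Mono l := Preadditive.mono_of_cancel_zero _ fun g hg => hl g hg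
    exact B.prop_of_mono l (B.prop_biprod (p.prop_diag_obj _) (p.prop_diag_obj _))

/-- A Serre subcategory is closed under finite products; hence it is an abelian category. -/
instance : B.IsClosedUnderFiniteProducts :=
  ObjectProperty.IsClosedUnderFiniteProducts.mk'

/-- The torsion functor `τ : A ⥤ B`, right adjoint to the inclusion functor. -/
noncomputable def torsionFunctor [IsLocalizing B] : A ⥤ B.FullSubcategory :=
  B.ι.rightAdjoint

/-- The inclusion functor is left adjoint to the torsion functor. -/
noncomputable def torsionAdj [IsLocalizing B] : B.ι ⊣ torsionFunctor B :=
  Adjunction.ofIsLeftAdjoint B.ι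

instance [IsLocalizing B] : (torsionFunctor B).Additive :=
  (torsionAdj B).right_adjoint_additive

/-- The Serre quotient `A / B`: the localization of `A` with respect to the morphisms whose kernel
and cokernel lie in `B`. -/
abbrev SerreQuotient : Type u := B.isoModSerre.Localization

noncomputable instance : Abelian (SerreQuotient B) :=
  ObjectProperty.SerreClassLocalization.abelian B.isoModSerre.Q B

/-- The quotient functor `π : A ⥤ A / B`. -/
abbrev quotientFunctor : A ⥤ SerreQuotient B := B.isoModSerre.Q

end Defs

/-! ### The section functor exists, and `A / B` has enough injective objects -/

section Zorn

variable {C : Type u} [Category.{v} C] [Abelian C]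

lemma mono_comp_cokernel_π_kernelSubobject {S I Q : C} (s : S ⟶ I) (q : I ⟶ Q) [Mono (s ≫ q)] :
    Mono (s ≫ cokernel.π (kernelSubobject q).arrow) := by
  have h : (s ≫ cokernel.π (kernelSubobject q).arrow) ≫
      cokernel.desc _ q (kernelSubobject_arrow_comp q) = s ≫ q := by simp
  have : Mono ((s ≫ cokernel.π (kernelSubobject q).arrow) ≫
      cokernel.desc _ q (kernelSubobject_arrow_comp q)) := by rw [h]; infer_instance
  exact mono_of_mono _ (cokernel.desc _ q (kernelSubobject_arrow_comp q))

/-- The quotients of `I` by a functorial family of subobjects. -/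
noncomputable def quotFunctor {I : C} {J : Type w} [Preorder J] (K : J →o Subobject I) : J ⥤ C where
  obj j := cokernel (K j).arrow
  map {i j} f := cokernel.map _ _ (Subobject.ofLE _ _ (K.monotone (leOfHom f))) (𝟙 I) (by simp)
  map_id j := by
    rw [← cancel_epi (cokernel.π _)]
    simp
  map_comp f g := by
    rw [← cancel_epi (cokernel.π _)]
    simp

lemma quotFunctor_π_map {I : C} {J : Type w} [Preorder J] (K : J →o Subobject I) {i j : J}
    (f : i ⟶ j) :
    cokernel.π (K i).arrow ≫ (quotFunctor K).map f = cokernel.π (K j).arrow := by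
  dsimp [quotFunctor]
  simp

lemma exists_upper_bound_aux [IsGrothendieckAbelian.{w} C] {S I : C} (s : S ⟶ I)
    {J : Type w} [Preorder J] [Nonempty J] [IsDirectedOrder J] (F : J →o Subobject I)
    (h : ∀ j, Mono (s ≫ cokernel.π (F j).arrow)) :
    ∃ K' : Subobject I, Mono (s ≫ cokernel.π K'.arrow) ∧ ∀ j, F j ≤ K' := by
  have : IsConnected J := IsFiltered.isConnected _
  let G := quotFunctor F
  let j₀ : J := Classical.arbitrary _
  let p (j : J) : I ⟶ G.obj j := cokernel.π (F j).arrow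
  let q (j : J) : I ⟶ colimit G := p j ≫ colimit.ι G j
  have hle : ∀ i j, i ≤ j → q i = q j := fun i j hij => by
    have h₁ : p i ≫ G.map (homOfLE hij) = p j := quotFunctor_π_map F (homOfLE hij)
    dsimp only [q]
    rw [← colimit.w G (homOfLE hij), ← Category.assoc, h₁]
  have hq : ∀ i j, q i = q j := fun i j => by
    obtain ⟨k, hik, hjk⟩ := exists_ge_ge i j
    rw [hle i k hik, hle j k hjk]
  let φ : (Functor.const J).obj S ⟶ G :=
    { app := fun j => s ≫ p j
      naturality := fun i j f => by
        have h₁ : p i ≫ G.map f = p j := quotFunctor_π_map F f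
        simp [h₁] }
  have : ∀ j, Mono (φ.app j) := h
  have : Mono φ := NatTrans.mono_of_mono_app φ
  have : Mono (s ≫ q j₀) :=
    colim.map_mono' φ (isColimitConstCocone _ S) (colimit.isColimit G) (s ≫ q j₀) (fun j => by
      rw [hq j₀ j]
      dsimp [φ, q]
      rw [Category.assoc]
      exact Category.id_comp _)
  refine ⟨kernelSubobject (q j₀), mono_comp_cokernel_π_kernelSubobject _ _, fun j => ?_⟩
  refine le_kernelSubobject _ _ ?_
  have h₂ : (F j).arrow ≫ p j = 0 := cokernel.condition _
  rw [hq j₀ j, ← Category.assoc, h₂, zero_comp]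

lemma exists_upper_bound [IsGrothendieckAbelian.{w} C] {S I : C} (s : S ⟶ I)
    (c : Set (Subobject I)) (hc : IsChain (· ≤ ·) c) (hne : c.Nonempty)
    (h : ∀ K ∈ c, Mono (s ≫ cokernel.π K.arrow)) :
    ∃ K' : Subobject I, Mono (s ≫ cokernel.π K'.arrow) ∧ ∀ K ∈ c, K ≤ K' := by
  have : Small.{w} c := inferInstance
  obtain ⟨J, ⟨e⟩⟩ := this.equiv_small
  let _ : Preorder J := Preorder.lift fun j => (e.symm j).1
  let F : J →o Subobject I := ⟨fun j => (e.symm j).1, fun _ _ hij => hij⟩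
  have : Nonempty J := ⟨e ⟨_, hne.some_mem⟩⟩
  have : IsDirectedOrder J := ⟨fun i j => by
    rcases hc.total (e.symm i).2 (e.symm j).2 with hij | hij
    · exact ⟨j, hij, le_refl (F j)⟩
    · exact ⟨i, le_refl (F i), hij⟩⟩
  obtain ⟨K', h₁, h₂⟩ := exists_upper_bound_aux s F (fun j => h _ (e.symm j).2)
  refine ⟨K', h₁, fun K hK => ?_⟩
  have h₃ : F (e ⟨K, hK⟩) = K := congrArg Subtype.val (e.symm_apply_apply ⟨K, hK⟩)
  exact h₃ ▸ h₂ (e ⟨K, hK⟩)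

lemma exists_isEssentialMono_comp [IsGrothendieckAbelian.{w} C] {S I : C} (s : S ⟶ I) [Mono s] :
    ∃ (Q : C) (q : I ⟶ Q), IsEssentialMono (s ≫ q) := by
  obtain ⟨K, hK⟩ := zorn_le₀ {K : Subobject I | Mono (s ≫ cokernel.π K.arrow)} (fun c hcs hc => by
    rcases c.eq_empty_or_nonempty with rfl | hne
    · have : Mono (s ≫ 𝟙 I) := by rw [Category.comp_id]; infer_instance
      exact ⟨kernelSubobject (𝟙 I), mono_comp_cokernel_π_kernelSubobject s (𝟙 I), by simp⟩
    · obtain ⟨K', h₁, h₂⟩ := exists_upper_bound.{w} s c hc hne (fun K hK => hcs hK)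
      exact ⟨K', h₁, h₂⟩)
  refine ⟨_, cokernel.π K.arrow, hK.prop, fun Z g hg => ?_⟩
  have : Mono (s ≫ cokernel.π K.arrow ≫ g) := by rwa [← Category.assoc]
  have h₁ := mono_comp_cokernel_π_kernelSubobject s (cokernel.π K.arrow ≫ g)
  have h₂ : K ≤ kernelSubobject (cokernel.π K.arrow ≫ g) :=
    le_kernelSubobject _ _ (by rw [← Category.assoc, cokernel.condition, zero_comp])
  have h₃ := hK.le_of_ge h₁ h₂
  refine Preadditive.mono_of_cancel_zero _ fun {W} x hx => ?_
  have e : pullback.snd x (cokernel.π K.arrow) ≫ cokernel.π K.arrow = 0 := by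
    have hf : (kernelSubobject (cokernel.π K.arrow ≫ g)).Factors
        (pullback.snd x (cokernel.π K.arrow)) := by
      rw [kernelSubobject_factors_iff, ← pullback.condition_assoc, hx, comp_zero]
    have hf' := Subobject.factors_of_le _ h₃ hf
    rw [← Subobject.factorThru_arrow _ _ hf', Category.assoc, cokernel.condition, comp_zero]
  rw [← pullback.condition] at e
  exact (cancel_epi (pullback.fst x (cokernel.π K.arrow))).1 (by rw [e, comp_zero])

end Zorn

section Torsion

variable {C : Type u} [Category.{v} C] [Abelian C] (B : ObjectProperty C) [B.IsSerreClass]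

/-- An object is torsion-free if it receives no nonzero morphism from an object of `B`. -/
def IsTorsionFree (Y : C) : Prop := ∀ ⦃X : C⦄, B X → ∀ f : X ⟶ Y, f = 0

variable {B} in
lemma IsTorsionFree.isLocal {I : C} [Injective I] (hI : IsTorsionFree B I) :
    B.isoModSerre.isLocal I := by
  intro X Y f hf
  constructor
  · intro g₁ g₂ h
    have h' : f ≫ (g₁ - g₂) = 0 := by simpa [Preadditive.comp_sub, sub_eq_zero] using h
    have := hI hf.2 (cokernel.desc f _ h')
    rw [← sub_eq_zero, ← cokernel.π_desc f _ h', this, comp_zero]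
  · intro h
    have h' : kernel.ι f ≫ h = 0 := hI hf.1 _
    refine ⟨Injective.factorThru (cokernel.desc _ h h') (Abelian.factorThruCoimage f), ?_⟩
    have h₁ : Abelian.factorThruCoimage f ≫ Injective.factorThru (cokernel.desc _ h h')
        (Abelian.factorThruCoimage f) = cokernel.desc _ h h' := Injective.comp_factorThru _ _
    have h₂ := congrArg (fun k => Abelian.coimage.π f ≫ k) h₁
    dsimp only at h₂ ⊢
    rw [← Category.assoc, Abelian.coimage.fac] at h₂
    exact h₂.trans (cokernel.π_desc _ _ _)

variable {B} in
lemma isLocal_kernel {X Y : C} (u : X ⟶ Y) (hX : B.isoModSerre.isLocal X)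
    (hY : IsTorsionFree B Y) : B.isoModSerre.isLocal (kernel u) := by
  intro W V f hf
  constructor
  · intro g₁ g₂ h
    rw [← cancel_mono (kernel.ι u)]
    refine (hX f hf).1 ?_
    dsimp only at h ⊢
    rw [← Category.assoc, h, Category.assoc]
  · intro g
    obtain ⟨k, hk⟩ := (hX f hf).2 (g ≫ kernel.ι u)
    dsimp only at hk
    have h₀ : f ≫ k ≫ u = 0 := by rw [← Category.assoc, hk]; simp
    have h₁ : k ≫ u = 0 := by
      rw [← cokernel.π_desc f _ h₀, hY hf.2 (cokernel.desc f _ h₀), comp_zero]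
    refine ⟨kernel.lift u k h₁, ?_⟩
    rw [← cancel_mono (kernel.ι u)]
    simp [hk]

variable [IsLocalizing B]

/-- The largest subobject of `X` that lies in `B`. -/
noncomputable abbrev torsionι (X : C) : ((torsionFunctor B).obj X).obj ⟶ X :=
  (torsionAdj B).counit.app X

lemma exists_torsion_lift {X Y : C} (hY : B Y) (f : Y ⟶ X) :
    ∃ g, g ≫ torsionι B X = f :=
  ⟨(((torsionAdj B).homEquiv ⟨Y, hY⟩ X) f).hom, by
    have := (torsionAdj B).homEquiv_counit (X := ⟨Y, hY⟩) (Y := X)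
      (g := (torsionAdj B).homEquiv ⟨Y, hY⟩ X f)
    rw [Equiv.symm_apply_apply] at this
    exact this.symm⟩

instance mono_torsionι (X : C) : Mono (torsionι B X) := by
  rw [Preadditive.mono_iff_cancel_zero]
  have hK : kernel.ι (torsionι B X) = 0 := by
    have hP : B (kernel (torsionι B X)) :=
      B.prop_of_mono (kernel.ι (torsionι B X)) ((torsionFunctor B).obj X).property
    let a : (⟨_, hP⟩ : B.FullSubcategory) ⟶ (torsionFunctor B).obj X :=
      ObjectProperty.homMk (kernel.ι (torsionι B X))
    have ha : a = 0 := by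
      apply ((torsionAdj B).homEquiv _ _).symm.injective
      rw [Adjunction.homEquiv_counit, Adjunction.homEquiv_counit]
      have h₁ : B.ι.map a ≫ (torsionAdj B).counit.app X = 0 := kernel.condition _
      rw [h₁, Functor.map_zero, zero_comp]
    exact congrArg (fun f => f.hom) ha
  intro W g hg
  rw [← kernel.lift_ι _ g hg, hK, comp_zero]

/-- The quotient of an object by its torsion subobject. -/
noncomputable abbrev torsionQuot (X : C) : C := cokernel (torsionι B X)

lemma prop_kernel_torsionQuot (X : C) : B (kernel (cokernel.π (torsionι B X))) :=
  B.prop_of_epi (Abelian.factorThruImage (torsionι B X)) ((torsionFunctor B).obj X).property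

lemma isTorsionFree_torsionQuot (X : C) : IsTorsionFree B (torsionQuot B X) := by
  intro Y hY f
  let p := cokernel.π (torsionι B X)
  have hE : B (pullback f p) := by
    have hk : B (kernel (pullback.fst f p)) :=
      B.monoModSerre.pullback_fst f p (prop_kernel_torsionQuot B X)
    have hS : (ShortComplex.mk (kernel.ι (pullback.fst f p)) (pullback.fst f p)
      (kernel.condition _)).ShortExact := { exact := ShortComplex.exact_kernel _ }
    exact B.prop_X₂_of_shortExact hS hk hY
  obtain ⟨g, hg⟩ := exists_torsion_lift B hE (pullback.snd f p)
  rw [← cancel_epi (pullback.fst f p), pullback.condition, ← hg, Category.assoc,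
    cokernel.condition, comp_zero, comp_zero]

lemma exists_torsionFree_injective [IsGrothendieckAbelian.{w} C] [IsClosedUnderEssentialMonos B]
    {Y : C} (hY : IsTorsionFree B Y) :
    ∃ (I : C) (_ : Injective I) (_ : IsTorsionFree B I) (m : Y ⟶ I), Mono m := by
  have : EnoughInjectives C := IsGrothendieckAbelian.enoughInjectives.{w}
  let I := Injective.under Y
  let t := torsionι B I
  obtain ⟨Q, q, hq⟩ := exists_isEssentialMono_comp.{w} t
  have hQ : B Q := IsClosedUnderEssentialMonos.prop_of_isEssentialMono _ hq
    ((torsionFunctor B).obj I).property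
  have := hq.1
  obtain ⟨g, hg⟩ := exists_torsion_lift B hQ (Injective.factorThru t (t ≫ q))
  let r : I ⟶ ((torsionFunctor B).obj I).obj := q ≫ g
  have hr : t ≫ r = 𝟙 _ := by
    rw [← cancel_mono t]
    have : (t ≫ q) ≫ g ≫ t = t := by
      rw [hg]; exact Injective.comp_factorThru _ _
    simpa [r] using this
  let k : I ⟶ kernel r := kernel.lift r (𝟙 I - r ≫ t) (by simp [Preadditive.sub_comp, hr])
  have hk : kernel.ι r ≫ k = 𝟙 _ := by
    rw [← cancel_mono (kernel.ι r)]
    simp [k, Preadditive.comp_sub]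
  refine ⟨kernel r, ⟨fun {X Z} f i _ => ⟨Injective.factorThru (f ≫ kernel.ι r) i ≫ k, ?_⟩⟩, ?_,
    Injective.ι Y ≫ k, ?_⟩
  · rw [← Category.assoc, Injective.comp_factorThru, Category.assoc, hk, Category.comp_id]
  · intro X hX f
    obtain ⟨a, ha⟩ := exists_torsion_lift B hX (f ≫ kernel.ι r)
    have h₀ : a = 0 := by
      have : (a ≫ t) ≫ r = 0 := by
        rw [show a ≫ t = f ≫ kernel.ι r from ha, Category.assoc, kernel.condition, comp_zero]
      rwa [Category.assoc, hr, Category.comp_id] at this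
    rw [← cancel_mono (kernel.ι r), ← ha, h₀, zero_comp, zero_comp]
  · rw [Preadditive.mono_iff_cancel_zero]
    intro X f hf
    have h₁ : f ≫ Injective.ι Y = (f ≫ Injective.ι Y ≫ r) ≫ t := by
      have : (f ≫ Injective.ι Y ≫ k) ≫ kernel.ι r = 0 := by rw [hf, zero_comp]
      simp only [k, Category.assoc, kernel.lift_ι, Preadditive.comp_sub,
        sub_eq_zero] at this
      rw [Category.assoc, Category.assoc]
      refine Eq.trans ?_ this
      congr 1
      exact (Category.comp_id _).symm
    have h₂ : B (Abelian.image f) := by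
      have hm : Mono (Abelian.image.ι f ≫ Injective.ι Y ≫ r) := by
        rw [Preadditive.mono_iff_cancel_zero]
        intro V x hx
        have h₃ : Abelian.image.ι f ≫ Injective.ι Y
            = (Abelian.image.ι f ≫ Injective.ι Y ≫ r) ≫ t := by
          rw [← cancel_epi (Abelian.factorThruImage f)]
          simpa using h₁
        rw [← cancel_mono (Abelian.image.ι f ≫ Injective.ι Y), zero_comp, h₃,
          ← Category.assoc, hx, zero_comp]
      exact B.prop_of_mono (Abelian.image.ι f ≫ Injective.ι Y ≫ r)
        ((torsionFunctor B).obj I).property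
    rw [← Abelian.image.fac f, hY h₂ (Abelian.image.ι f), comp_zero]

lemma exists_isLocal [IsGrothendieckAbelian.{w} C] [IsClosedUnderEssentialMonos B] (X : C) :
    ∃ (Z : C) (f : X ⟶ Z), B.isoModSerre f ∧ B.isoModSerre.isLocal Z := by
  obtain ⟨I, _, hI, m, _⟩ := exists_torsionFree_injective.{w} B (isTorsionFree_torsionQuot B X)
  obtain ⟨J, _, hJ, n, _⟩ :=
    exists_torsionFree_injective.{w} B (isTorsionFree_torsionQuot B (cokernel m))
  let v : cokernel m ⟶ J := cokernel.π (torsionι B (cokernel m)) ≫ n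
  have hv : B (kernel v) :=
    B.prop_of_iso (kernelCompMono _ n).symm (prop_kernel_torsionQuot B (cokernel m))
  let u : I ⟶ J := cokernel.π m ≫ v
  have hmu : m ≫ u = 0 := by simp [u]
  let e : torsionQuot B X ⟶ kernel u := kernel.lift u m hmu
  have he : e ≫ kernel.ι u = m := kernel.lift_ι _ _ _
  have : Mono e := by
    have : Mono (e ≫ kernel.ι u) := by rw [he]; infer_instance
    exact mono_of_mono e (kernel.ι u)
  let a : kernel u ⟶ kernel v := kernel.lift v (kernel.ι u ≫ cokernel.π m) (by
    rw [Category.assoc]; exact kernel.condition u)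
  have ha : a ≫ kernel.ι v = kernel.ι u ≫ cokernel.π m := kernel.lift_ι _ _ _
  have hea : e ≫ a = 0 := by
    rw [← cancel_mono (kernel.ι v), Category.assoc, ha, ← Category.assoc, he]
    simp
  have hex : (ShortComplex.mk e a hea).Exact := by
    refine ShortComplex.exact_of_f_is_kernel _ (KernelFork.IsLimit.ofι' _ _ fun {W} k hk => ?_)
    have h₁ : (k ≫ kernel.ι u) ≫ cokernel.π m = 0 := by
      rw [Category.assoc, ← ha, ← Category.assoc]
      erw [hk]
      rw [zero_comp]
    have hS := ShortComplex.exact_cokernel m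
    have : Mono (ShortComplex.mk m (cokernel.π m) (cokernel.condition m)).f := by
      dsimp; infer_instance
    refine ⟨hS.lift _ h₁, ?_⟩
    rw [← cancel_mono (kernel.ι u), Category.assoc]
    erw [he]
    exact hS.lift_f _ h₁
  have hce : B.epiModSerre e := by
    have := hex.mono_cokernelDesc
    exact B.prop_of_mono (cokernel.desc e a hea) hv
  refine ⟨kernel u, cokernel.π (torsionι B X) ≫ e, ?_, isLocal_kernel u hI.isLocal hJ⟩
  exact B.isoModSerre.comp_mem _ _
    (B.isoModSerre_of_epi _ (prop_kernel_torsionQuot B X)) (B.isoModSerre_of_mono e hce)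

end Torsion

section Quotient

variable {C : Type u} [Category.{v} C] [Abelian C] (B : ObjectProperty C) [B.IsSerreClass]

lemma quotientFunctor_map_bijective (Y : C) {Z : C} (hZ : B.isoModSerre.isLocal Z) :
    Function.Bijective (fun f : Y ⟶ Z => (quotientFunctor B).map f) := by
  constructor
  · intro f g h
    obtain ⟨X, s, hs, h'⟩ := (MorphismProperty.map_eq_iff_precomp _ B.isoModSerre f g).1 h
    exact (hZ s hs).1 h'
  · intro f
    obtain ⟨φ, rfl⟩ := Localization.exists_rightFraction (quotientFunctor B) B.isoModSerre f
    obtain ⟨g, hg⟩ := (hZ φ.s φ.hs).2 φ.f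
    dsimp only at hg
    refine ⟨g, ?_⟩
    have := Localization.inverts (quotientFunctor B) B.isoModSerre φ.s φ.hs
    dsimp only
    rw [← cancel_epi ((quotientFunctor B).map φ.s), MorphismProperty.RightFraction.map_s_comp_map,
      ← Functor.map_comp, hg]

lemma exists_iso_isLocal [IsLocalizing B] [IsGrothendieckAbelian.{w} C]
    [IsClosedUnderEssentialMonos B] (M : SerreQuotient B) :
    ∃ Z : C, B.isoModSerre.isLocal Z ∧ Nonempty ((quotientFunctor B).obj Z ≅ M) := by
  have := Localization.essSurj (quotientFunctor B) B.isoModSerre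
  obtain ⟨Z, f, hf, hZ⟩ := exists_isLocal.{w} B ((quotientFunctor B).objPreimage M)
  exact ⟨Z, hZ, ⟨(Localization.isoOfHom (quotientFunctor B) B.isoModSerre f hf).symm ≪≫
    (quotientFunctor B).objObjPreimageIso M⟩⟩

/-- The quotient functor `π : A ⥤ A / B` has a right adjoint. -/
instance isLeftAdjoint_quotientFunctor [IsLocalizing B] [IsGrothendieckAbelian.{w} C]
    [IsClosedUnderEssentialMonos B] : (quotientFunctor B).IsLeftAdjoint := by
  rw [isLeftAdjoint_iff_hasTerminal_costructuredArrow]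
  intro M
  obtain ⟨Z, hZ, ⟨e⟩⟩ := exists_iso_isLocal.{w} B M
  have hex : ∀ T : CostructuredArrow (quotientFunctor B) M,
      ∃ f : T.left ⟶ Z, (quotientFunctor B).map f = T.hom ≫ e.inv := fun T =>
    (quotientFunctor_map_bijective B T.left hZ).2 (T.hom ≫ e.inv)
  refine IsTerminal.hasTerminal (X := CostructuredArrow.mk e.hom) (IsTerminal.ofUniqueHom
    (fun T => CostructuredArrow.homMk (hex T).choose ?_) (fun T f => ?_))
  · have := (hex T).choose_spec
    dsimp
    rw [this]
    simp
  · apply CostructuredArrow.ext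
    apply (quotientFunctor_map_bijective B T.left hZ).1
    refine Eq.trans ?_ (hex T).choose_spec.symm
    rw [Iso.eq_comp_inv]
    exact CostructuredArrow.w f

/-- The quotient category `A / B` has enough injective objects. -/
instance enoughInjectives_serreQuotient [IsLocalizing B] [IsGrothendieckAbelian.{w} C]
    [IsClosedUnderEssentialMonos B] : EnoughInjectives (SerreQuotient B) where
  presentation M := by
    have := Localization.essSurj (quotientFunctor B) B.isoModSerre
    let X := (quotientFunctor B).objPreimage M
    obtain ⟨I, _, hI, m, _⟩ := exists_torsionFree_injective.{w} B (isTorsionFree_torsionQuot B X)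
    have h₁ : B.isoModSerre (cokernel.π (torsionι B X)) :=
      B.isoModSerre_of_epi _ (prop_kernel_torsionQuot B X)
    have := Localization.inverts (quotientFunctor B) B.isoModSerre _ h₁
    have := ObjectProperty.SerreClassLocalization.preservesMonomorphisms (quotientFunctor B) B
    have hinj : Injective ((quotientFunctor B).obj I) := ⟨fun {U V} g f hf => by
      obtain ⟨X', Y', f', _, ⟨a⟩⟩ :=
        (ObjectProperty.SerreClassLocalization.mono_iff (quotientFunctor B) B f).1 hf
      let a₁ : (quotientFunctor B).obj X' ≅ U := Arrow.leftFunc.mapIso a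
      let a₂ : (quotientFunctor B).obj Y' ≅ V := Arrow.rightFunc.mapIso a
      have comm : a₁.hom ≫ f = (quotientFunctor B).map f' ≫ a₂.hom := a.hom.w
      obtain ⟨g', hg'⟩ := (quotientFunctor_map_bijective B X' hI.isLocal).2 (a₁.hom ≫ g)
      refine ⟨a₂.inv ≫ (quotientFunctor B).map (Injective.factorThru g' f'), ?_⟩
      have comm' : f ≫ a₂.inv = a₁.inv ≫ (quotientFunctor B).map f' := by
        rw [Iso.comp_inv_eq, Category.assoc, ← comm, Iso.inv_hom_id_assoc]
      rw [← Category.assoc, comm', Category.assoc, ← Functor.map_comp,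
        Injective.comp_factorThru]
      dsimp only at hg'
      rw [hg', Iso.inv_hom_id_assoc]⟩
    exact ⟨{
      J := (quotientFunctor B).obj I
      injective := hinj
      f := ((quotientFunctor B).objObjPreimageIso M).inv ≫
        (quotientFunctor B).map (cokernel.π (torsionι B X)) ≫ (quotientFunctor B).map m
      mono := inferInstance }⟩

/-- The section functor `ω : A / B ⥤ A`, right adjoint to the quotient functor. -/
noncomputable def sectionFunctor [(quotientFunctor B).IsLeftAdjoint] : SerreQuotient B ⥤ C :=
  (quotientFunctor B).rightAdjoint

/-- The quotient functor is left adjoint to the section functor. -/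
noncomputable def sectionAdj [(quotientFunctor B).IsLeftAdjoint] :
    quotientFunctor B ⊣ sectionFunctor B :=
  Adjunction.ofIsLeftAdjoint (quotientFunctor B)

instance [(quotientFunctor B).IsLeftAdjoint] : (sectionFunctor B).Additive :=
  (sectionAdj B).right_adjoint_additive

end Quotient

end SerreQuot

/-! Two comparisons of complexes carry the proof. For an adjunction `L ⊣ R` and an injective
resolution `J` of `Y`, the complexes `Hom(L T, J)` and `Hom(T, R J)` agree. The cohomology of the
first is `Ext(L T, Y)`; that of `R J` itself gives the derived functors of `R`. If `Ext(L T, Y)`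
vanishes in some positive degree and `T` is a generator, then `R J` is exact there
(`cohDim_rightAdjoint_le_projDim`). Conversely, if `L` preserves monomorphisms, `R J` consists of
injectives; where it is exact, dimension shifting along its cocycles bounds the degrees with `Ext(L
T, Y) ≠ 0` by `coh.dim R + proj.dim T` (`projDim_obj_le_cohDim_add_projDim`).

For `τ` and `ω`, closure under essential monomorphisms makes the torsion part of an injective a
direct summand. Hence `0 → τI → I → ωπI → 0` is exact for `I` injective, and `π` preserves
injectives. Applied to an injective resolution of `X`, the long exact sequence gives `R^{n+1}ω(πX) ≅
R^{n+2}τ(X)` for `n ≥ 0`, whence `cohDim_section_eq`. The finiteness statements follow from the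
inequalities and this equality. -/

namespace SerreQuot

/-! ### Dimensions and derived functors through injective resolutions -/

section Dimension

variable {C : Type u} [Category.{v} C] [Abelian C]

lemma cohDim_le_iff [HasInjectiveResolutions C] {D : Type u'} [Category.{v'} D] [Abelian D]
    (F : C ⥤ D) [F.Additive] (n : ℕ) :
    cohDim F ≤ n ↔ ∀ m, n < m → ∀ X, IsZero ((F.rightDerived m).obj X) := by
  simp only [cohDim, sSup_le_iff, Set.forall_mem_image, Nat.cast_le, Set.mem_ofPred_eq,
    ← Functor.isZero_iff]
  exact forall_congr' fun m => by rw [← not_lt, not_imp_not]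

/-- An injective resolution is sent to an injective resolution by an exact functor which
preserves injective objects. -/
noncomputable def mapInjectiveResolution {D : Type u'} [Category.{v'} D] [Abelian D]
    (F : C ⥤ D) [F.Additive] [F.PreservesInjectiveObjects] [F.PreservesHomology] {Z : C}
    (I : InjectiveResolution Z) : InjectiveResolution (F.obj Z) where
  cocomplex := (F.mapHomologicalComplex _).obj I.cocomplex
  injective n := F.injective_obj_of_injective (I.injective n)
  ι := (HomologicalComplex.singleMapHomologicalComplex _ _ _).inv.app _ ≫
    (F.mapHomologicalComplex _).map I.ι
  quasiIso := inferInstance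

lemma isZero_rightDerived_obj_iff [HasInjectiveResolutions C] {D : Type u'} [Category.{v'} D]
    [Abelian D] (F : C ⥤ D) [F.Additive] {X : C} (I : InjectiveResolution X) (n : ℕ) :
    IsZero ((F.rightDerived n).obj X) ↔
      ((F.mapHomologicalComplex _).obj I.cocomplex).ExactAt n := by
  rw [HomologicalComplex.exactAt_iff_isZero_homology]
  exact (I.isoRightDerivedObj F n).isZero_iff

lemma exactAt_map_iff {D : Type u'} [Category.{v'} D] [Abelian D]
    (F : C ⥤ D) [F.Additive] [F.PreservesHomology] [F.Faithful] {ι : Type*}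
    {c : ComplexShape ι} (K : HomologicalComplex C c) (n : ι) :
    ((F.mapHomologicalComplex c).obj K).ExactAt n ↔ K.ExactAt n :=
  ShortComplex.exact_map_iff_of_faithful (K.sc n) F

end Dimension

/-! ### Lifting cocycles: Ext, exactness and dimension shifting -/

section Lifting

variable {C : Type u} [Category.{v} C] [Abelian C]

/-- Every morphism from `T` to the `n + 1`-cocycles of `K` lifts to `K.X n`. -/
def LiftsCocycles (T : C) (K : CochainComplex C ℕ) (n : ℕ) : Prop :=
  ∀ f : T ⟶ K.X (n + 1), f ≫ K.d (n + 1) (n + 2) = 0 → ∃ g : T ⟶ K.X n, g ≫ K.d n (n + 1) = f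

lemma liftsCocycles_map_iff {D : Type u'} [Category.{v'} D] [Abelian D] {L : C ⥤ D} {R : D ⥤ C}
    [R.Additive] (adj : L ⊣ R) (T : C) (K : CochainComplex D ℕ) (n : ℕ) :
    LiftsCocycles T ((R.mapHomologicalComplex _).obj K) n ↔ LiftsCocycles (L.obj T) K n := by
  have h (i j : ℕ) (f : L.obj T ⟶ K.X i) : adj.homEquiv _ _ (f ≫ K.d i j) =
      adj.homEquiv _ _ f ≫ R.map (K.d i j) := adj.homEquiv_naturality_right _ _
  have h₀ (i : ℕ) : adj.homEquiv T (K.X i) 0 = 0 := by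
    simp [Adjunction.homEquiv_unit]
  change (∀ f : T ⟶ R.obj (K.X (n + 1)), f ≫ R.map (K.d (n + 1) (n + 2)) = 0 →
    ∃ g : T ⟶ R.obj (K.X n), g ≫ R.map (K.d n (n + 1)) = f) ↔ _
  constructor
  · intro H f hf
    obtain ⟨g, hg⟩ := H (adj.homEquiv _ _ f) (by rw [← h, hf, h₀])
    refine ⟨(adj.homEquiv _ _).symm g, (adj.homEquiv _ _).injective ?_⟩
    rw [h, Equiv.apply_symm_apply, hg]
  · intro H f hf
    obtain ⟨g, hg⟩ := H ((adj.homEquiv _ _).symm f) (by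
      apply (adj.homEquiv _ _).injective
      rw [h, Equiv.apply_symm_apply, h₀, hf])
    exact ⟨adj.homEquiv _ _ g, by rw [← h, hg, Equiv.apply_symm_apply]⟩

/-- `Ext` is the cohomology of `Hom(T, J)`: a class is a cocycle `T ⟶ J^{n+1}`, and it vanishes
exactly when that cocycle is a coboundary. -/
lemma liftsCocycles_iff_forall_ext_eq_zero [HasExt.{w} C] (T : C) {Y : C}
    (J : InjectiveResolution Y) (n : ℕ) :
    LiftsCocycles T J.cocomplex n ↔ ∀ e : Abelian.Ext T Y (n + 1), e = 0 := by
  constructor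
  · intro H e
    obtain ⟨f, hf, rfl⟩ := J.extMk_surjective e (n + 2) rfl
    exact (J.extMk_eq_zero_iff f _ rfl hf n rfl).2 (H f hf)
  · intro H f hf
    exact (J.extMk_eq_zero_iff f _ rfl hf n rfl).1 (H _)

lemma exactAt_succ_iff (K : CochainComplex C ℕ) (n : ℕ) :
    K.ExactAt (n + 1) ↔
      (ShortComplex.mk _ _ (K.d_comp_d n (n + 1) (n + 2))).Exact :=
  HomologicalComplex.exactAt_iff' _ n (n + 1) (n + 2) (by simp)
    (by simp only [CochainComplex.next]; rfl)

/-- Every map from `T` to the cocycles lifts to cochains, so it dies in the cokernel of cochains →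
cocycles. As `T` is a separator, the projection onto that cokernel is zero. Projectivity of `T` is
not needed, since only maps to the cocycles are tested. -/
lemma LiftsCocycles.exactAt {T : C} (hT : IsSeparator T) {K : CochainComplex C ℕ} {n : ℕ}
    (h : LiftsCocycles T K n) : K.ExactAt (n + 1) := by
  rw [exactAt_succ_iff, ShortComplex.exact_iff_epi_kernel_lift]
  refine Preadditive.epi_of_cokernel_zero ?_
  refine (Preadditive.isSeparator_iff T).1 hT _ fun f => ?_
  obtain ⟨g, hg⟩ := h (f ≫ kernel.ι _) (by simp)
  have : g ≫ kernel.lift (K.d (n + 1) (n + 2)) (K.d n (n + 1)) (by simp) = f := by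
    rw [← cancel_mono (kernel.ι _), Category.assoc, kernel.lift_ι, hg]
  dsimp only
  rw [← this, Category.assoc, cokernel.condition, comp_zero]

/-- The `n`-cocycles, the `n`-cochains and the `n + 1`-cocycles of a complex. -/
noncomputable abbrev cocyclesSequence (K : CochainComplex C ℕ) (n : ℕ) : ShortComplex C :=
  ShortComplex.mk (kernel.ι (K.d n (n + 1)))
    (kernel.lift (K.d (n + 1) (n + 2)) (K.d n (n + 1)) (by simp))
    (by rw [← cancel_mono (kernel.ι _)]; simp)

lemma cocyclesSequence_shortExact {K : CochainComplex C ℕ} {n : ℕ} (h : K.ExactAt (n + 1)) :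
    (cocyclesSequence K n).ShortExact where
  exact := by
    refine ShortComplex.exact_of_f_is_kernel _ (KernelFork.IsLimit.ofι' _ _ fun k hk => ?_)
    have : k ≫ K.d n (n + 1) = 0 := by
      have := congrArg (fun t => t ≫ kernel.ι (K.d (n + 1) (n + 2))) hk
      simpa using this
    exact ⟨kernel.lift _ k this, kernel.lift_ι _ _ _⟩
  epi_g := by
    rw [exactAt_succ_iff, ShortComplex.exact_iff_epi_kernel_lift] at h
    exact h

/-- Dimension shifting along the cocycles of a complex of injective objects. -/
lemma ext_cocycles_eq_zero [HasExt.{w} C] (T : C) (K : CochainComplex C ℕ)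
    [∀ n, Injective (K.X n)] {c d : ℕ} (hK : ∀ n, c ≤ n → K.ExactAt (n + 1))
    [HasProjectiveDimensionLT T (d + 1)] (j i : ℕ) (hij : d ≤ i + j)
    (e : Abelian.Ext T (kernel (K.d (c + j) (c + j + 1))) (i + 1)) : e = 0 := by
  induction j generalizing i with
  | zero => exact e.eq_zero_of_hasProjectiveDimensionLT (d + 1) (by omega)
  | succ j ih =>
    have hS := cocyclesSequence_shortExact (hK (c + j) (by omega))
    -- The connecting map sends `e` into `Ext^{i+2}` of the preceding cocycles, which is zero by
    -- induction; so `e` comes from `Ext^{i+1}` into an injective object.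
    obtain ⟨x, rfl⟩ := Abelian.Ext.covariant_sequence_exact₃ T hS e rfl
      (ih (i + 1) (by omega) _)
    rw [x.eq_zero_of_injective, Abelian.Ext.zero_comp]

/-- The obstruction to lifting lies in `Ext¹(T, Zⁿ)`, with `Zⁿ` the `n`-cocycles. Shifting down to
`Z^c` costs `n - c ≥ d` degrees, past the projective dimension of `T`. -/
lemma liftsCocycles_of_hasProjectiveDimensionLT (T : C) (K : CochainComplex C ℕ)
    [∀ n, Injective (K.X n)] {c d : ℕ} (hK : ∀ n, c ≤ n → K.ExactAt (n + 1))
    [HasProjectiveDimensionLT T (d + 1)] (n : ℕ) (hn : c + d ≤ n) : LiftsCocycles T K n := by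
  let := HasExt.standard C
  intro f hf
  obtain ⟨j, rfl⟩ := Nat.exists_eq_add_of_le (show c ≤ n by omega)
  have hS := cocyclesSequence_shortExact (hK (c + j) (by omega))
  obtain ⟨x, hx⟩ := Abelian.Ext.covariant_sequence_exact₃ T hS
    (Abelian.Ext.mk₀ (kernel.lift _ f hf)) rfl
    (ext_cocycles_eq_zero (d := d) T K hK j 0 (by omega) _)
  obtain ⟨g, rfl⟩ := (Abelian.Ext.mk₀_bijective T _).2 x
  rw [Abelian.Ext.mk₀_comp_mk₀] at hx
  have hg := congrArg (fun t => t ≫ kernel.ι (K.d (c + j + 1) (c + j + 2)))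
    ((Abelian.Ext.mk₀_bijective T _).1 hx)
  exact ⟨g, by simpa using hg⟩

end Lifting

/-! ### The two inequalities for an adjunction -/

section Adjunction

variable {C : Type u} [Category.{v} C] [Abelian C] {D : Type u'} [Category.{v'} D] [Abelian D]
  [HasInjectiveResolutions D] {L : C ⥤ D} {R : D ⥤ C} [R.Additive]

lemma cohDim_rightAdjoint_le_projDim (adj : L ⊣ R) {T : C} (hT : IsSeparator T) :
    cohDim R ≤ projDim (L.obj T) := by
  rcases eq_or_ne (projDim (L.obj T)) ⊤ with h | h
  · simp [h]
  obtain ⟨n, hn⟩ := ENat.ne_top_iff_exists.1 h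
  have : HasProjectiveDimensionLT (L.obj T) (n + 1) := (projDim_le_iff _ n).1 hn.ge
  rw [← hn]
  rw [cohDim_le_iff]
  intro m hm Y
  let := HasExt.standard D
  obtain ⟨J⟩ := (HasInjectiveResolutions.out Y).out
  obtain ⟨m, rfl⟩ := Nat.exists_eq_add_one_of_ne_zero (by omega : m ≠ 0)
  rw [isZero_rightDerived_obj_iff R J]
  refine LiftsCocycles.exactAt hT ((liftsCocycles_map_iff adj _ _ _).2 ?_)
  rw [liftsCocycles_iff_forall_ext_eq_zero]
  exact fun e => e.eq_zero_of_hasProjectiveDimensionLT (n + 1) (by omega)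

lemma projDim_obj_le_cohDim_add_projDim [L.PreservesMonomorphisms] (adj : L ⊣ R) (T : C) :
    projDim (L.obj T) ≤ cohDim R + projDim T := by
  rcases eq_or_ne (cohDim R) ⊤ with hc | hc
  · simp [hc]
  rcases eq_or_ne (projDim T) ⊤ with hd | hd
  · simp [hd]
  obtain ⟨c, hc⟩ := ENat.ne_top_iff_exists.1 hc
  obtain ⟨d, hd⟩ := ENat.ne_top_iff_exists.1 hd
  rw [← hc, ← hd, ← Nat.cast_add, projDim_le_iff]
  have hR := (cohDim_le_iff R c).1 hc.ge
  have : HasProjectiveDimensionLT T (d + 1) := (projDim_le_iff T d).1 hd.ge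
  let := HasExt.standard D
  refine (hasProjectiveDimensionLT_iff _ _).2 fun i hi Y => ?_
  obtain ⟨J⟩ := (HasInjectiveResolutions.out Y).out
  obtain ⟨i, rfl⟩ := Nat.exists_eq_add_one_of_ne_zero (by omega : i ≠ 0)
  rw [← liftsCocycles_iff_forall_ext_eq_zero _ J, ← liftsCocycles_map_iff adj]
  -- A right adjoint of a functor preserving monomorphisms preserves injectives.
  have (n : ℕ) : Injective (((R.mapHomologicalComplex _).obj J.cocomplex).X n) :=
    Injective.injective_of_adjoint adj (J.cocomplex.X n)
  refine liftsCocycles_of_hasProjectiveDimensionLT T _ (c := c) (d := d) (fun n hn => ?_) i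
    (by omega)
  exact (isZero_rightDerived_obj_iff R J _).1 (hR _ (by omega) Y)

end Adjunction

end SerreQuot


namespace SerreQuot

/-! ### Comparison of the torsion and section functors -/

section Comparison

variable {C : Type u} [Category.{v} C] [Abelian C] (B : ObjectProperty C) [B.IsSerreClass]

instance preservesHomology_ι : B.ι.PreservesHomology where
  preservesKernels _ _ f := B.preservesKernels_ι f
  preservesCokernels _ _ f := B.preservesCokernels_ι f

instance preservesFiniteLimits_quotientFunctor : PreservesFiniteLimits (quotientFunctor B) :=
  ObjectProperty.SerreClassLocalization.preservesFiniteLimits _ B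

instance preservesFiniteColimits_quotientFunctor : PreservesFiniteColimits (quotientFunctor B) :=
  ObjectProperty.SerreClassLocalization.preservesFiniteColimits _ B

section Torsion

variable [IsLocalizing B]

/-- In an injective object the torsion subobject is a direct summand. -/
lemma isSplitMono_torsionι [IsGrothendieckAbelian.{w} C] [IsClosedUnderEssentialMonos B]
    (I : C) [Injective I] : IsSplitMono (torsionι B I) := by
  -- `Q` is a quotient of `I` in which the torsion part is essential, so `Q` is itself in `B`. Any
  -- map `Q ⟶ I` then lands in the torsion part; the one extending `torsionι B I` gives the
  -- retraction.
  obtain ⟨Q, q, hq⟩ := exists_isEssentialMono_comp.{w} (torsionι B I)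
  have hQ : B Q := IsClosedUnderEssentialMonos.prop_of_isEssentialMono _ hq
    ((torsionFunctor B).obj I).property
  have := hq.1
  obtain ⟨g, hg⟩ := exists_torsion_lift B hQ
    (Injective.factorThru (torsionι B I) (torsionι B I ≫ q))
  refine ⟨⟨q ≫ g, ?_⟩⟩
  rw [← cancel_mono (torsionι B I), Category.assoc, Category.assoc, hg, ← Category.assoc]
  exact (Injective.comp_factorThru _ _).trans (Category.id_comp _).symm

lemma injective_torsionQuot [IsGrothendieckAbelian.{w} C] [IsClosedUnderEssentialMonos B]
    (I : C) [Injective I] : Injective (torsionQuot B I) := by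
  have := isSplitMono_torsionι.{w} B I
  have h : torsionι B I ≫ (𝟙 I - retraction (torsionι B I) ≫ torsionι B I) = 0 := by
    rw [Preadditive.comp_sub, IsSplitMono.id_assoc, Category.comp_id]
    exact sub_self _
  refine Retract.injective (Y := I) ⟨cokernel.desc _ _ h, cokernel.π _, ?_⟩
  rw [← cancel_epi (cokernel.π (torsionι B I)), cokernel.π_desc_assoc, Preadditive.sub_comp,
    Category.assoc, cokernel.condition, comp_zero, sub_zero]
  exact (Category.id_comp _).trans (Category.comp_id _).symm

lemma isLocal_torsionQuot [IsGrothendieckAbelian.{w} C] [IsClosedUnderEssentialMonos B]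
    (I : C) [Injective I] : B.isoModSerre.isLocal (torsionQuot B I) :=
  have := injective_torsionQuot.{w} B I
  (isTorsionFree_torsionQuot B I).isLocal

instance isIso_map_torsionQuot_π (X : C) :
    IsIso ((quotientFunctor B).map (cokernel.π (torsionι B X))) :=
  Localization.inverts (quotientFunctor B) B.isoModSerre _
    (B.isoModSerre_of_epi _ (prop_kernel_torsionQuot B X))

end Torsion

section Section

variable [(quotientFunctor B).IsLeftAdjoint]

/-- The unit `X ⟶ ω (π X)` of the adjunction between the quotient and section functors. -/
noncomputable abbrev sectionUnit (X : C) : X ⟶ (sectionFunctor B).obj ((quotientFunctor B).obj X) :=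
  (sectionAdj B).unit.app X

/-- By Yoneda: composing with the unit is the action of `π` on `Hom(Y, Z)`, bijective for local `Z`,
followed by the adjunction bijection. -/
lemma isIso_sectionUnit {Z : C} (hZ : B.isoModSerre.isLocal Z) : IsIso (sectionUnit B Z) := by
  refine isIso_of_yoneda_map_bijective _ fun Y => ?_
  have h : (fun f : Y ⟶ Z => f ≫ sectionUnit B Z) =
      (sectionAdj B).homEquiv _ _ ∘ fun f : Y ⟶ Z => (quotientFunctor B).map f := by
    funext f
    simp only [Function.comp, Adjunction.homEquiv_unit]
    exact (sectionAdj B).unit.naturality f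
  rw [h]
  exact ((sectionAdj B).homEquiv _ _).bijective.comp (quotientFunctor_map_bijective B Y hZ)

/-- Every object of the quotient is `πZ` with `Z` local, up to isomorphism. There the unit is
invertible, and the triangle identity makes the counit invertible too. -/
lemma isIso_sectionAdj_counit [IsLocalizing B] [IsGrothendieckAbelian.{w} C]
    [IsClosedUnderEssentialMonos B] : IsIso (sectionAdj B).counit := by
  refine (NatTrans.isIso_iff_isIso_app _).2 fun M => ?_
  obtain ⟨Z, hZ, ⟨e⟩⟩ := exists_iso_isLocal.{w} B M
  have := isIso_sectionUnit B hZ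
  have h := (sectionAdj B).left_triangle_components Z
  have h' : IsIso ((sectionAdj B).counit.app ((quotientFunctor B).obj Z)) :=
    (IsIso.eq_inv_of_hom_inv_id h) ▸ inferInstance
  exact (NatTrans.isIso_app_iff_of_iso _ e).1 h'

variable [IsLocalizing B]

lemma torsionι_comp_sectionUnit (X : C) : torsionι B X ≫ sectionUnit B X = 0 := by
  apply ((sectionAdj B).homEquiv _ _).symm.injective
  -- The transposed maps start at `π(τX)`, which is zero because `τX` lies in `B`.
  exact (IsZero.eq_of_src ((ObjectProperty.SerreClassLocalization.isZero_obj_iff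
    (quotientFunctor B) B _).2 ((torsionFunctor B).obj X).property) _ _)

/-- The hypothesis is the transpose of `π f = 0`, which says that the image of `f` lies in `B`. -/
lemma exists_torsion_lift_of_comp_sectionUnit_eq_zero {W X : C} (f : W ⟶ X)
    (hf : f ≫ sectionUnit B X = 0) : ∃ g, g ≫ torsionι B X = f := by
  have h₀ : (quotientFunctor B).map f = 0 := by
    apply ((sectionAdj B).homEquiv _ _).injective
    have h := (sectionAdj B).unit.naturality f
    rw [Adjunction.homEquiv_unit, Adjunction.homEquiv_unit, Functor.map_zero, comp_zero]
    exact h.symm.trans hf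
  obtain ⟨g, hg⟩ := exists_torsion_lift B
    ((ObjectProperty.SerreClassLocalization.map_eq_zero_iff (quotientFunctor B) B f).1 h₀)
    (Abelian.image.ι f)
  exact ⟨Abelian.factorThruImage f ≫ g, by rw [Category.assoc, hg, Abelian.image.fac]⟩

/-- The kernel of the unit `X ⟶ ω (π X)` is the torsion subobject of `X`. -/
lemma exact_torsionι_sectionUnit (X : C) :
    (ShortComplex.mk _ _ (torsionι_comp_sectionUnit B X)).Exact :=
  ShortComplex.exact_of_f_is_kernel _ (KernelFork.IsLimit.ofι' _ _ fun f hf =>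
    have h := exists_torsion_lift_of_comp_sectionUnit_eq_zero B f hf
    ⟨h.choose, h.choose_spec⟩)

variable [IsGrothendieckAbelian.{w} C] [IsClosedUnderEssentialMonos B]

/-- Naturality of the unit along `I ⟶ I/τI`: `π` inverts this projection, and the unit at `I/τI` is
invertible because that quotient is local. -/
lemma sectionUnit_eq_of_injective (I : C) [Injective I] :
    ∃ e : torsionQuot B I ≅ (sectionFunctor B).obj ((quotientFunctor B).obj I),
      sectionUnit B I = cokernel.π (torsionι B I) ≫ e.hom := by
  have := isIso_sectionUnit B (isLocal_torsionQuot.{w} B I)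
  let p := cokernel.π (torsionι B I)
  have hp : IsIso ((sectionFunctor B).map ((quotientFunctor B).map p)) := inferInstance
  refine ⟨asIso (sectionUnit B (torsionQuot B I)) ≪≫
    (asIso ((sectionFunctor B).map ((quotientFunctor B).map p))).symm, ?_⟩
  have h := (sectionAdj B).unit.naturality p
  dsimp only [Iso.trans_hom, Iso.symm_hom, asIso_inv, asIso_hom]
  rw [← Category.assoc, IsIso.eq_comp_inv]
  exact h.symm

lemma epi_sectionUnit_of_injective (I : C) [Injective I] : Epi (sectionUnit B I) := by
  obtain ⟨e, he⟩ := sectionUnit_eq_of_injective.{w} B I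
  rw [he]
  infer_instance

/-- `ωπI ≅ I/τI` is injective, and `ω`, being a fully faithful right adjoint, reflects injectivity.
-/
lemma preservesInjectiveObjects_quotientFunctor :
    (quotientFunctor B).PreservesInjectiveObjects where
  injective_obj {I} hI := by
    have := isIso_sectionAdj_counit.{w} B
    have := (sectionAdj B).fullyFaithfulROfIsIsoCounit.full
    have := (sectionAdj B).fullyFaithfulROfIsIsoCounit.faithful
    obtain ⟨e, -⟩ := sectionUnit_eq_of_injective.{w} B I
    exact (sectionAdj B).injective_of_map_injective _
      (Injective.of_iso e (injective_torsionQuot.{w} B I))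

/-- The complexes `τ K`, `K` and `ω (π K)`. -/
noncomputable abbrev torsionSectionSequence (K : CochainComplex C ℕ) :
    ShortComplex (CochainComplex C ℕ) :=
  ShortComplex.mk ((NatTrans.mapHomologicalComplex (torsionAdj B).counit _).app K)
    ((NatTrans.mapHomologicalComplex (sectionAdj B).unit _).app K)
    (by ext n; exact torsionι_comp_sectionUnit B (K.X n))

lemma torsionSectionSequence_shortExact (K : CochainComplex C ℕ) [∀ n, Injective (K.X n)] :
    (torsionSectionSequence B K).ShortExact :=
  HomologicalComplex.shortExact_of_degreewise_shortExact _ fun n =>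
    { exact := exact_torsionι_sectionUnit B (K.X n)
      mono_f := mono_torsionι B (K.X n)
      epi_g := epi_sectionUnit_of_injective.{w} B (K.X n) }

lemma isZero_rightDerived_section_iff [HasInjectiveResolutions C]
    [HasInjectiveResolutions (SerreQuotient B)] (X : C) (n : ℕ) :
    IsZero (((sectionFunctor B).rightDerived (n + 1)).obj ((quotientFunctor B).obj X)) ↔
      IsZero (((torsionFunctor B).rightDerived (n + 2)).obj X) := by
  obtain ⟨I⟩ := (HasInjectiveResolutions.out X).out
  have := preservesInjectiveObjects_quotientFunctor.{w} B
  rw [isZero_rightDerived_obj_iff _ I,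
    isZero_rightDerived_obj_iff _ (mapInjectiveResolution (quotientFunctor B) I),
    -- `τI` is a complex in `B`, while the short exact sequence lives in the ambient category; the
    -- inclusion is exact and faithful, so exactness may be tested there.
    ← exactAt_map_iff B.ι]
  have hS := torsionSectionSequence_shortExact.{w} B I.cocomplex
  have h₂ (m : ℕ) : IsZero ((torsionSectionSequence B I.cocomplex).X₂.homology (m + 1)) :=
    (HomologicalComplex.exactAt_iff_isZero_homology _ _).1 (I.cocomplex_exactAt_succ m)
  -- The connecting map is invertible because the resolution has no cohomology in degrees `n + 1`
  -- and `n + 2`. Degree `0`, where its cohomology is `X`, is avoided.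
  have e := hS.δIso (n + 1) (n + 2) rfl (h₂ _) (h₂ _)
  exact (HomologicalComplex.exactAt_iff_isZero_homology _ _).trans
    (e.isZero_iff.trans (HomologicalComplex.exactAt_iff_isZero_homology _ _).symm)

/-- Both sides have the same natural upper bounds, which determines an element of `ℕ∞`. Subtraction
is truncated, so the case `coh.dim τ = 0` is covered. -/
lemma cohDim_section_eq [HasInjectiveResolutions C] [HasInjectiveResolutions (SerreQuotient B)] :
    cohDim (sectionFunctor B) = cohDim (torsionFunctor B) - 1 := by
  have key (n : ℕ) : cohDim (sectionFunctor B) ≤ n ↔ cohDim (torsionFunctor B) ≤ n + 1 := by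
    rw [← Nat.cast_one, ← Nat.cast_add, cohDim_le_iff, cohDim_le_iff]
    constructor
    · intro h m hm X
      obtain ⟨m, rfl⟩ := Nat.exists_eq_add_of_le (show 2 ≤ m by omega)
      rw [add_comm, ← isZero_rightDerived_section_iff.{w}]
      exact h _ (by omega) _
    · intro h m hm M
      obtain ⟨m, rfl⟩ := Nat.exists_eq_add_one_of_ne_zero (by omega : m ≠ 0)
      -- The comparison concerns objects `πX` only; essential surjectivity of `π` extends it to all
      -- `M`.
      obtain ⟨Z, -, ⟨e⟩⟩ := exists_iso_isLocal.{w} B M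
      refine IsZero.of_iso ?_ (((sectionFunctor B).rightDerived (m + 1)).mapIso e.symm)
      rw [isZero_rightDerived_section_iff.{w}]
      exact h _ (by omega) _
  have key' (n : ℕ) : cohDim (sectionFunctor B) ≤ n ↔ cohDim (torsionFunctor B) - 1 ≤ n :=
    (key n).trans tsub_le_iff_right.symm
  refine le_antisymm ?_ ?_
  · rcases eq_or_ne (cohDim (torsionFunctor B) - 1) ⊤ with h | h
    · simp [h]
    · obtain ⟨n, hn⟩ := ENat.ne_top_iff_exists.1 h
      exact hn ▸ (key' n).2 hn.ge
  · rcases eq_or_ne (cohDim (sectionFunctor B)) ⊤ with h | h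
    · simp [h]
    · obtain ⟨n, hn⟩ := ENat.ne_top_iff_exists.1 h
      exact hn ▸ (key' n).1 hn.ge

end Section

end Comparison

end SerreQuot

theorem proposition4p3 {A : Type u} [Category.{v} A] [Abelian A] [IsGrothendieckAbelian.{w} A]
    (B : ObjectProperty A) [B.IsSerreClass] [SerreQuot.IsLocalizing B]
    [SerreQuot.IsClosedUnderEssentialMonos B]
    (T : A) (hT : IsSeparator T) (hTpd : SerreQuot.projDim T < ⊤) :
    (SerreQuot.projDim ((SerreQuot.quotientFunctor B).obj T) < ⊤ ↔
        SerreQuot.cohDim (SerreQuot.sectionFunctor B) < ⊤) ∧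
      (SerreQuot.cohDim (SerreQuot.sectionFunctor B) < ⊤ ↔
        SerreQuot.cohDim (SerreQuot.torsionFunctor B) < ⊤) ∧
      SerreQuot.cohDim (SerreQuot.sectionFunctor B) =
        max 0 (SerreQuot.cohDim (SerreQuot.torsionFunctor B) - 1) ∧
      SerreQuot.cohDim (SerreQuot.sectionFunctor B) ≤
        SerreQuot.projDim ((SerreQuot.quotientFunctor B).obj T) ∧
      SerreQuot.projDim ((SerreQuot.quotientFunctor B).obj T) ≤
        SerreQuot.cohDim (SerreQuot.sectionFunctor B) + SerreQuot.projDim T := by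
  have h₁ := SerreQuot.cohDim_rightAdjoint_le_projDim (SerreQuot.sectionAdj B) hT
  have h₂ := SerreQuot.projDim_obj_le_cohDim_add_projDim (SerreQuot.sectionAdj B) T
  have h₃ := SerreQuot.cohDim_section_eq.{w} B
  refine ⟨⟨h₁.trans_lt, fun h => h₂.trans_lt (ENat.add_lt_top.2 ⟨h, hTpd⟩)⟩, ?_, ?_, h₁, h₂⟩
  -- In `ℕ∞`, subtracting `1` does not affect being infinite.
  · rw [h₃, lt_top_iff_ne_top, lt_top_iff_ne_top, not_iff_not, ENat.sub_eq_top_iff]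
    simp
  · rw [h₃]
    simp
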